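/- Let $G$ be a finite group, $g\in G$ an element of order $\mathrm o(g)$, and $N$ a natural number. Let $C^{2N}_G$ be the set of $2N$-conjugacy classes, i.e. of orbits of $G$ acting by simultaneous conjugation on $N$-tuples $((h_1|y_1),\dots,(h_N|y_N))$ of pairs of elements of $G$. Let $\mathrm{Map}_{N,1}$ be the mapping class group of the genus-$N$ surface with one boundary circle, realized as the group of those automorphisms of the free group $F_{2N}$ on $a_1,b_1,\dots,a_N,b_N$ that fix the boundary word $\prod_{i=1}^N [a_i,b_i]$, where $[x,y]=x^{-1}y^{-1}xy$, and let $\mathrm{Map}_N$ be the mapping class group of the closed oriented surface $\Sigma_N$ of genus $N$, i.e. the image of $\mathrm{Map}_{N,1}$ in the group of outer automorphisms of $\pi_1(\Sigma_N)=F_{2N}/\langle\langle \prod_i [a_i,b_i]\rangle\rangle$. Identify a tuple $((h_i|y_i))_i$ with the homomorphism $\rho\colon F_{2N}\to G$, $a_i\mapsto h_i$, $b_i\mapsto y_i$. Then $\mathrm{Map}_{N,1}$ acts on $C^{2N}_G$ by $\varphi\cdot[\rho]=[\rho\circ\varphi^{-1}]$, and on the classes of tuples with $\prod_i[h_i,y_i]=e$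 this action descends to an action of $\mathrm{Map}_N$. For $v=(m_1,\dots,m_N,n_1,\dots,n_N)\in\mathbb Z^{2N}$ let $[g^v]\in C^{2N}_G$ be the class of $((g^{m_1}|g^{n_1}),\dots,(g^{m_N}|g^{n_N}))$ and put $\gamma(v)=\gcd(m_1,\dots,m_N,n_1,\dots,n_N,\mathrm o(g))$. (i) For all $v,w\in\mathbb Z^{2N}$ with $\gamma(v)=\gamma(w)$, the class $[g^w]$ lies in the $\mathrm{Map}_N$-orbit of $[g^v]$. Moreover, the $\mathrm{Map}_N$-action on the set $X_g=\{[g^v] : v\in\mathbb Z^{2N}\}$ factors through an action of $\mathrm{Sp}(2N,\mathbb Z)$: the action of $\mathrm{Map}_N$ on $H^1(\Sigma_N;\mathbb Z)=\mathrm{Hom}(\pi_1(\Sigma_N),\mathbb Z)\cong\mathbb Z^{2N}$, $\varphi\cdot f=f\circ\varphi^{-1}$ (equivalently, by Poincaré duality, on $H_1(\Sigma_N;\mathbb Z)$), is given by a homomorphism $s\colon\mathrm{Map}_N\to\mathrm{Sp}(2N,\mathbb Z)$, the formula $A\cdot[g^v]=[g^{Av}]$ defines an action of $\mathrm{Sp}(2N,\mathbb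 Z)$ on $X_g$, and $\varphi\cdot d=s(\varphi)\cdot d$ for all $\varphi\in\mathrm{Map}_N$ and $d\in X_g$. (ii) Suppose that any two different elements of the cyclic subgroup $\langle g\rangle$ belong to distinct conjugacy classes of $G$. Then $[g^v]$ and $[g^w]$ lie in the same $\mathrm{Map}_N$-orbit if and only if $\gamma(v)=\gamma(w)$. Moreover, $v\mapsto[g^v]$ induces an injective map $P\colon(\mathbb Z/\mathrm o(g)\mathbb Z)^{2N}\to C^{2N}_G$, and for every $z$ the $\mathrm{Map}_N$-orbit of $P(z)$ is the image under $P$ of the orbit of $z$ under the defining action of $\mathrm{Sp}(2N,\mathbb Z/\mathrm o(g)\mathbb Z)$ on $(\mathbb Z/\mathrm o(g)\mathbb Z)^{2N}$. -/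

import Mathlib

/-! ## Tuples `((h₁|y₁),…,(h_N|y_N))` and `2N`-conjugacy classes -/

namespace MCG

/-- `G^{×2N}`: `N`-tuples of pairs `(h|y)` of elements of `G`. -/
abbrev Tuple (N : ℕ) (G : Type*) : Type _ := Fin N → G × G

/-- The group commutator `[h,y] = h⁻¹ y⁻¹ h y` of a pair. -/
def pairComm {G : Type*} [Group G] (p : G × G) : G := p.1⁻¹ * p.2⁻¹ * p.1 * p.2

/-- The multi-commutator `[h₁,y₁] [h₂,y₂] ⋯ [h_N,y_N]`. -/
def multiComm {N : ℕ} {G : Type*} [Group G] (t : Tuple N G) : G :=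
  (List.ofFn fun i => pairComm (t i)).prod

/-- Apply a homomorphism to all entries of a tuple. -/
def mapTuple {N : ℕ} {G H : Type*} [Group G] [Group H] (f : G →* H) (t : Tuple N G) :
    Tuple N H := fun i => (f (t i).1, f (t i).2)

theorem multiComm_map {N : ℕ} {G H : Type*} [Group G] [Group H] (f : G →* H) (t : Tuple N G) :
    multiComm (mapTuple f t) = f (multiComm t) := by
  simp [multiComm, mapTuple, pairComm, map_list_prod, List.map_ofFn, Function.comp_def]

/-- Simultaneous conjugation of all entries, as the action of `ConjAct G` on tuples. -/
theorem smul_eq_mapTuple {N : ℕ} {G : Type*} [Group G] (c : ConjAct G) (t : Tuple N G) :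
    c • t = mapTuple (MulAut.conj (ConjAct.ofConjAct c)).toMonoidHom t := by
  funext i
  simp [mapTuple, ConjAct.smul_def, Prod.ext_iff]

/-- `C^{2N}_G`, the set of `2N`-conjugacy classes: orbits of simultaneous conjugation
on `G^{×2N}`. -/
abbrev TupleClass (N : ℕ) (G : Type*) [Group G] : Type _ :=
  MulAction.orbitRel.Quotient (ConjAct G) (Tuple N G)

/-- The `2N`-conjugacy class of a tuple. -/
def classOf {N : ℕ} {G : Type*} [Group G] (t : Tuple N G) : TupleClass N G := Quotient.mk _ t

theorem classOf_eq_iff {N : ℕ} {G : Type*} [Group G] {t u : Tuple N G} :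
    classOf t = classOf u ↔ ∃ c : ConjAct G, c • u = t := by
  unfold classOf
  rw [Quotient.eq]
  exact MulAction.orbitRel_apply

/-- The map `μ_N : C^{2N}_G → C_G` induced by the multi-commutator. -/
def multiCommClass {N : ℕ} {G : Type*} [Group G] : TupleClass N G → ConjClasses G :=
  Quotient.lift (fun t => ConjClasses.mk (multiComm t)) (by
    intro a b hab
    obtain ⟨c, rfl⟩ := hab
    dsimp only
    rw [ConjClasses.mk_eq_mk_iff_isConj, smul_eq_mapTuple, multiComm_map]
    exact (isConj_iff.2 ⟨ConjAct.ofConjAct c, rfl⟩ : IsConj (multiComm b) _).symm)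

/-- The subset `μ_N⁻¹(c_e)` of `C^{2N}_G`: classes of tuples with trivial multi-commutator. -/
abbrev FlatClass (N : ℕ) (G : Type*) [Group G] : Type _ :=
  {d : TupleClass N G // multiCommClass d = ConjClasses.mk 1}

/-! ## The mapping class groups -/

/-- The free group of rank `2N`: the fundamental group of the genus-`N` surface with one
boundary circle (based on the boundary). -/
abbrev FreeSurf (N : ℕ) : Type := FreeGroup (Fin N ⊕ Fin N)

/-- The tuple of free generators. -/
def genTuple (N : ℕ) : Tuple N (FreeSurf N) :=
  fun i => (FreeGroup.of (Sum.inl i), FreeGroup.of (Sum.inr i))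

/-- The homotopy class of the boundary circle. -/
def boundaryWord (N : ℕ) : FreeSurf N := multiComm (genTuple N)

/-- `Map_{N,1}`, the mapping class group of the genus-`N` surface with one boundary circle
(homeomorphisms and isotopies fixing the boundary pointwise), in its description by
Dehn–Nielsen–Baer: the automorphisms of the fundamental group that fix the class of the
boundary circle. -/
def MapBdry (N : ℕ) : Subgroup (MulAut (FreeSurf N)) :=
  MulAction.stabilizer (MulAut (FreeSurf N)) (boundaryWord N)

/-- The fundamental group of the closed surface of genus `N`. -/
abbrev SurfaceGroup (N : ℕ) : Type := PresentedGroup ({boundaryWord N} : Set (FreeSurf N))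

theorem mapBdry_boundary {N : ℕ} (φ : MapBdry N) : φ.1 (boundaryWord N) = boundaryWord N := φ.2

/-- A mapping class of the surface with boundary acts on the closed surface group. -/
def inducedHom {N : ℕ} (φ : MapBdry N) : SurfaceGroup N →* SurfaceGroup N :=
  PresentedGroup.toGroup
    (f := fun k => PresentedGroup.mk {boundaryWord N} (φ.1 (FreeGroup.of k))) (by
      rintro r rfl
      have h : FreeGroup.lift (fun k => PresentedGroup.mk {boundaryWord N} (φ.1 (FreeGroup.of k)))
          = (PresentedGroup.mk {boundaryWord N}).comp φ.1.toMonoidHom := by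
        ext k; simp
      rw [h]
      have h2 := mapBdry_boundary φ
      simp only [MonoidHom.comp_apply, MulEquiv.toMonoidHom_eq_coe, MonoidHom.coe_coe, h2]
      exact PresentedGroup.one_of_mem (Set.mem_singleton _))

theorem inducedHom_mk {N : ℕ} (φ : MapBdry N) (x : FreeSurf N) :
    inducedHom φ (PresentedGroup.mk {boundaryWord N} x) =
      PresentedGroup.mk {boundaryWord N} (φ.1 x) := by
  have h : (inducedHom φ).comp (PresentedGroup.mk {boundaryWord N})
      = (PresentedGroup.mk {boundaryWord N}).comp φ.1.toMonoidHom := by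
    ext k
    simp only [MonoidHom.comp_apply]
    exact PresentedGroup.toGroup.of _
  exact DFunLike.congr_fun h x

/-- The kernel of `Map_{N,1} → Out(π₁ of the closed surface)`: those mapping classes which
become inner after the boundary circle is capped by a disk. -/
def capKernel (N : ℕ) : Subgroup (MapBdry N) where
  carrier := {φ | ∃ c : SurfaceGroup N, ∀ x : FreeSurf N,
    PresentedGroup.mk {boundaryWord N} (φ.1 x) =
      c * PresentedGroup.mk {boundaryWord N} x * c⁻¹}
  one_mem' := ⟨1, fun x => by simp⟩
  mul_mem' := by
    rintro φ ψ ⟨c, hc⟩ ⟨d, hd⟩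
    refine ⟨c * d, fun x => ?_⟩
    have : (φ * ψ).1 x = φ.1 (ψ.1 x) := rfl
    rw [this, hc, hd]
    group
  inv_mem' := by
    rintro φ ⟨c, hc⟩
    refine ⟨c⁻¹, fun x => ?_⟩
    have h := hc ((φ⁻¹).1 x)
    have h2 : φ.1 ((φ⁻¹).1 x) = x := MulAut.apply_inv_self _ φ.1 x
    rw [h2] at h
    rw [h]
    group

instance capKernel_normal (N : ℕ) : (capKernel N).Normal := by
  refine ⟨?_⟩
  rintro φ ⟨c, hc⟩ ψ
  refine ⟨inducedHom ψ c, fun x => ?_⟩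
  have h : (ψ * φ * ψ⁻¹).1 x = ψ.1 (φ.1 ((ψ⁻¹).1 x)) := rfl
  have h2 : ψ.1 ((ψ⁻¹).1 x) = x := MulAut.apply_inv_self _ ψ.1 x
  rw [h, ← inducedHom_mk, hc, map_mul, map_mul, inducedHom_mk, h2, map_inv]

/-- `Map_N = Map_{N,0}`, the mapping class group of the closed oriented surface of genus `N`:
the quotient of `Map_{N,1}` obtained by capping the hole, equivalently the group of outer
automorphisms of the closed surface group which are induced by `Map_{N,1}`. -/
abbrev MapClosed (N : ℕ) : Type := MapBdry N ⧸ capKernel N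

/-! ## The action on `2N`-conjugacy classes -/

/-- A tuple is the same thing as a homomorphism from the free group of rank `2N`. -/
def tupleHom {N : ℕ} {G : Type*} [Group G] (t : Tuple N G) : FreeSurf N →* G :=
  FreeGroup.lift (Sum.elim (fun i => (t i).1) (fun i => (t i).2))

theorem mapTuple_tupleHom_gen {N : ℕ} {G : Type*} [Group G] (t : Tuple N G) :
    mapTuple (tupleHom t) (genTuple N) = t := by
  funext i
  simp [mapTuple, tupleHom, genTuple]

theorem tupleHom_mapTuple {N : ℕ} {G H : Type*} [Group G] [Group H] (f : G →* H)
    (t : Tuple N G) : tupleHom (mapTuple f t) = f.comp (tupleHom t) := by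
  ext k
  rcases k with k | k <;> simp [mapTuple, tupleHom]

theorem tupleHom_gen (N : ℕ) : tupleHom (genTuple N) = MonoidHom.id (FreeSurf N) := by
  ext k
  rcases k with k | k <;> simp [genTuple, tupleHom]

theorem mapTuple_comp {N : ℕ} {G H K : Type*} [Group G] [Group H] [Group K] (f : G →* H)
    (f' : H →* K) (t : Tuple N G) : mapTuple f' (mapTuple f t) = mapTuple (f'.comp f) t := rfl

theorem multiComm_eq {N : ℕ} {G : Type*} [Group G] (t : Tuple N G) :
    multiComm t = tupleHom t (boundaryWord N) := by
  rw [boundaryWord, ← multiComm_map, mapTuple_tupleHom_gen]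

/-- The tuple that corresponds to the homomorphism `ρ ∘ φ⁻¹`, where `ρ` is the homomorphism
that corresponds to `t`. -/
def actTuple {N : ℕ} {G : Type*} [Group G] (φ : MulAut (FreeSurf N)) (t : Tuple N G) :
    Tuple N G :=
  mapTuple ((tupleHom t).comp (φ⁻¹).toMonoidHom) (genTuple N)

theorem tupleHom_actTuple {N : ℕ} {G : Type*} [Group G] (φ : MulAut (FreeSurf N))
    (t : Tuple N G) : tupleHom (actTuple φ t) = (tupleHom t).comp (φ⁻¹).toMonoidHom := by
  rw [actTuple, tupleHom_mapTuple, tupleHom_gen, MonoidHom.comp_id]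

theorem actTuple_one {N : ℕ} {G : Type*} [Group G] (t : Tuple N G) :
    actTuple (1 : MulAut (FreeSurf N)) t = t := by
  conv_rhs => rw [← mapTuple_tupleHom_gen t]
  rfl

theorem actTuple_mul {N : ℕ} {G : Type*} [Group G] (φ ψ : MulAut (FreeSurf N))
    (t : Tuple N G) : actTuple (φ * ψ) t = actTuple φ (actTuple ψ t) := by
  conv_rhs => rw [actTuple, tupleHom_actTuple]
  rw [actTuple, mul_inv_rev]
  rfl

theorem actTuple_mapTuple {N : ℕ} {G H : Type*} [Group G] [Group H] (φ : MulAut (FreeSurf N))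
    (f : G →* H) (t : Tuple N G) : actTuple φ (mapTuple f t) = mapTuple f (actTuple φ t) := by
  rw [actTuple, tupleHom_mapTuple]
  rfl

theorem multiComm_actTuple {N : ℕ} {G : Type*} [Group G] (φ : MapBdry N) (t : Tuple N G) :
    multiComm (actTuple φ.1 t) = multiComm t := by
  rw [multiComm_eq, multiComm_eq, tupleHom_actTuple]
  exact congrArg (tupleHom t) (mapBdry_boundary φ⁻¹)

/-- The induced map on `C^{2N}_G`. -/
def actClass {N : ℕ} {G : Type*} [Group G] (φ : MulAut (FreeSurf N)) :
    TupleClass N G → TupleClass N G :=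
  Quotient.map (actTuple φ) (by
    intro a b hab
    obtain ⟨c, rfl⟩ := hab
    refine ⟨c, ?_⟩
    dsimp only
    rw [smul_eq_mapTuple, smul_eq_mapTuple, actTuple_mapTuple])

theorem actClass_classOf {N : ℕ} {G : Type*} [Group G] (φ : MulAut (FreeSurf N))
    (t : Tuple N G) : actClass φ (classOf t) = classOf (actTuple φ t) := rfl

theorem actClass_one {N : ℕ} {G : Type*} [Group G] (d : TupleClass N G) :
    actClass 1 d = d := by
  induction d using Quotient.inductionOn with
  | h t => exact congrArg classOf (actTuple_one t)

theorem actClass_mul {N : ℕ} {G : Type*} [Group G] (φ ψ : MulAut (FreeSurf N))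
    (d : TupleClass N G) : actClass (φ * ψ) d = actClass φ (actClass ψ d) := by
  induction d using Quotient.inductionOn with
  | h t => exact congrArg classOf (actTuple_mul φ ψ t)

theorem multiCommClass_actClass {N : ℕ} {G : Type*} [Group G] (φ : MapBdry N)
    (d : TupleClass N G) : multiCommClass (actClass φ.1 d) = multiCommClass d := by
  induction d using Quotient.inductionOn with
  | h t => exact congrArg ConjClasses.mk (multiComm_actTuple φ t)

/-- The action of `Map_{N,1}` on all of `C^{2N}_G`. -/
def sigmaBdry (N : ℕ) (G : Type*) [Group G] : MapBdry N →* Equiv.Perm (TupleClass N G) :=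
  MonoidHom.toHomPerm
    { toFun := fun φ => (actClass φ.1 : Function.End (TupleClass N G))
      map_one' := funext actClass_one
      map_mul' := fun φ ψ => funext (actClass_mul φ.1 ψ.1) }

/-- The action of `Map_{N,1}` on the invariant subset `μ_N⁻¹(c_e)`. -/
def sigmaBdryFlat (N : ℕ) (G : Type*) [Group G] : MapBdry N →* Equiv.Perm (FlatClass N G) :=
  MonoidHom.toHomPerm
    { toFun := fun φ => ((fun d => ⟨sigmaBdry N G φ d.1,
        (multiCommClass_actClass φ d.1).trans d.2⟩) : Function.End (FlatClass N G))
      map_one' := by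
        funext d
        exact Subtype.ext (actClass_one d.1)
      map_mul' := by
        intro φ ψ
        funext d
        exact Subtype.ext (actClass_mul φ.1 ψ.1 d.1) }

theorem capKernel_le_ker (N : ℕ) (G : Type*) [Group G] :
    capKernel N ≤ (sigmaBdryFlat N G).ker := by
  intro φ hφ
  rw [MonoidHom.mem_ker]
  refine Equiv.ext ?_
  rintro ⟨d, hd⟩
  refine Subtype.ext ?_
  change actClass φ.1 d = d
  revert hd
  refine Quotient.inductionOn d (fun t => ?_)
  intro hd
  have hflat : multiComm t = 1 := by
    have h : IsConj (multiComm t) 1 := ConjClasses.mk_eq_mk_iff_isConj.1 hd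
    exact isConj_one_left.1 h
  obtain ⟨c, hc⟩ := (capKernel N).inv_mem hφ
  let r : SurfaceGroup N →* G := PresentedGroup.toGroup
    (f := Sum.elim (fun i => (t i).1) (fun i => (t i).2)) (by
      rintro r rfl
      exact (multiComm_eq t).symm.trans hflat)
  have hr : ∀ x, r (PresentedGroup.mk {boundaryWord N} x) = tupleHom t x := by
    intro x
    have h : r.comp (PresentedGroup.mk {boundaryWord N}) = tupleHom t := by
      ext k
      simp only [MonoidHom.comp_apply, tupleHom, FreeGroup.lift_apply_of]
      exact PresentedGroup.toGroup.of _
    exact DFunLike.congr_fun h x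
  have key : ∀ x, tupleHom t ((φ⁻¹).1 x) = r c * tupleHom t x * (r c)⁻¹ := by
    intro x
    rw [← hr, hc, map_mul, map_mul, map_inv, hr]
  refine classOf_eq_iff.2 ⟨ConjAct.toConjAct (r c), ?_⟩
  rw [smul_eq_mapTuple]
  conv_lhs => rw [← mapTuple_tupleHom_gen t]
  funext i
  exact (Prod.ext (key _) (key _)).symm

/-- The action `σ^N_G` of `Map_N` on `μ_N⁻¹(c_e) ⊆ C^{2N}_G`. -/
def sigma (N : ℕ) (G : Type*) [Group G] : MapClosed N →* Equiv.Perm (FlatClass N G) :=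
  QuotientGroup.lift (capKernel N) (sigmaBdryFlat N G) (capKernel_le_ker N G)

/-- The `Map_N`-orbit of a class. -/
def mapOrbit {N : ℕ} {G : Type*} [Group G] (d : FlatClass N G) : Set (FlatClass N G) :=
  {d' | ∃ φ : MapClosed N, sigma N G φ d = d'}

/-! ## The standard generators

The permutations of tuples by which the inverse Dehn twists about the standard curves and the
modular `S`-transformations act, with the proof that each of them is the action of an element
of `Map_{N,1}`. The position `i` is counted from the left, starting with `0`. -/

section Generators

variable {N : ℕ} {G : Type*} [Group G]

/-- `T : (g|x) ↦ (g|g⁻¹x)` at position `i`. -/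
def moveT (i : Fin N) (t : Tuple N G) : Tuple N G :=
  Function.update t i ((t i).1, (t i).1⁻¹ * (t i).2)

/-- `S : (g|x) ↦ (x⁻¹|x⁻¹gx)` at position `i`. -/
def moveS (i : Fin N) (t : Tuple N G) : Tuple N G :=
  Function.update t i ((t i).2⁻¹, (t i).2⁻¹ * (t i).1 * (t i).2)

/-- `U : (g|x) ↦ (xg|x)` at position `i`. -/
def moveU (i : Fin N) (t : Tuple N G) : Tuple N G :=
  Function.update t i ((t i).2 * (t i).1, (t i).2)

/-- `L : ((g|x),(h|y)) ↦ ((g|xhx⁻¹g⁻¹x),(khk⁻¹|kh⁻¹y))` with `k = x⁻¹gx`, at the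
positions `i`, `j` (where `j = i + 1`). -/
def moveL (i j : Fin N) (t : Tuple N G) : Tuple N G :=
  let g := (t i).1
  let x := (t i).2
  let h := (t j).1
  let y := (t j).2
  let k := x⁻¹ * g * x
  fun l => if l = i then (g, x * h * x⁻¹ * g⁻¹ * x)
    else if l = j then (k * h * k⁻¹, k * h⁻¹ * y) else t l

/-- The part of a tuple to the right of position `i`. -/
def tailTuple (i : Fin N) (t : Tuple N G) : Tuple N G := fun l => if i < l then t l else (1, 1)

/-- `M : ((g|x),(𝐡|𝐲)) ↦ ((g|xc⁻¹),(c𝐡c⁻¹|c𝐲c⁻¹))` with `c = x⁻¹gx · μ(𝐡|𝐲)`, where `(g|x)`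
stands at position `i` and `(𝐡|𝐲)` is the part of the tuple to its right. -/
def moveM (i : Fin N) (t : Tuple N G) : Tuple N G :=
  let g := (t i).1
  let x := (t i).2
  let c := x⁻¹ * g * x * multiComm (tailTuple i t)
  fun l => if l = i then (g, x * c⁻¹)
    else if i < l then (c * (t l).1 * c⁻¹, c * (t l).2 * c⁻¹) else t l

theorem multiComm_succ {n : ℕ} (t : Tuple (n + 1) G) :
    multiComm t = pairComm (t 0) * multiComm (fun l : Fin n => t l.succ) := by
  simp [multiComm, List.ofFn_succ]

theorem multiComm_congr {t u : Tuple N G} (h : ∀ l, pairComm (t l) = pairComm (u l)) :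
    multiComm t = multiComm u := by
  simp [multiComm, h]

theorem multiComm_update (i : Fin N) (t : Tuple N G) (p : G × G)
    (h : pairComm p = pairComm (t i)) : multiComm (Function.update t i p) = multiComm t := by
  refine multiComm_congr fun l => ?_
  by_cases hl : l = i
  · subst hl; simpa using h
  · simp [hl]

theorem multiComm_pair (i j : Fin N) (hij : (j : ℕ) = i + 1) (t u : Tuple N G)
    (h : ∀ l, l ≠ i → l ≠ j → u l = t l)
    (h2 : pairComm (u i) * pairComm (u j) = pairComm (t i) * pairComm (t j)) :
    multiComm u = multiComm t := by
  induction N with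
  | zero => exact i.elim0
  | succ n ih =>
    obtain ⟨j', rfl⟩ : ∃ j' : Fin n, j = j'.succ :=
      Fin.exists_succ_eq.2 (fun h0 => by simp [h0] at hij) |>.imp fun _ h => h.symm
    rw [multiComm_succ, multiComm_succ t]
    by_cases hi : i = 0
    · subst hi
      cases n with
      | zero => exact j'.elim0
      | succ m =>
        have hj : j' = 0 := by
          apply Fin.ext; simpa using hij
        subst hj
        rw [multiComm_succ, multiComm_succ fun l : Fin (m + 1) => t l.succ, ← mul_assoc,
          ← mul_assoc, h2]
        congr 1
        refine multiComm_congr fun l => ?_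
        rw [h l.succ.succ (Fin.succ_ne_zero _)
          (fun hh => Fin.succ_ne_zero _ (Fin.succ_injective _ hh))]
    · obtain ⟨i', rfl⟩ := Fin.exists_succ_eq.2 hi
      rw [h 0 (Fin.succ_ne_zero _).symm (Fin.succ_ne_zero _).symm]
      congr 1
      refine ih i' j' (by simpa using hij) _ _ (fun l h3 h4 => ?_) h2
      exact h l.succ (fun hh => h3 (Fin.succ_injective _ hh))
        (fun hh => h4 (Fin.succ_injective _ hh))

theorem multiComm_tail (i : Fin N) (t u : Tuple N G)
    (h : ∀ l, l < i → u l = t l)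
    (h2 : pairComm (u i) * multiComm (tailTuple i u) =
      pairComm (t i) * multiComm (tailTuple i t)) :
    multiComm u = multiComm t := by
  induction N with
  | zero => exact i.elim0
  | succ n ih =>
    rw [multiComm_succ, multiComm_succ t]
    by_cases hi : i = 0
    · subst hi
      rw [multiComm_succ, multiComm_succ (tailTuple 0 t)] at h2
      simpa [tailTuple, pairComm] using h2
    · obtain ⟨i', rfl⟩ := Fin.exists_succ_eq.2 hi
      rw [h 0 (Fin.succ_pos _)]
      congr 1
      refine ih i' _ _ (fun l hl => h l.succ (Fin.succ_lt_succ_iff.2 hl)) ?_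
      rw [multiComm_succ, multiComm_succ (tailTuple i'.succ t)] at h2
      have h0 : ∀ z : Tuple (n + 1) G, pairComm (tailTuple i'.succ z 0) = 1 := by
        intro z; simp [tailTuple, pairComm]
      have h3 : ∀ z : Tuple (n + 1) G, (fun l : Fin n => tailTuple i'.succ z l.succ) =
          tailTuple i' fun l => z l.succ := by
        intro z; funext l; simp [tailTuple]
      rwa [h0, h0, one_mul, one_mul, h3, h3] at h2

/-- A pair of mutually inverse tuples of words, with multi-commutator the boundary word,
defines an element of `Map_{N,1}`. -/
theorem exists_mapBdry (w w' : Tuple N (FreeSurf N))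
    (h1 : mapTuple (tupleHom w) w' = genTuple N) (h2 : mapTuple (tupleHom w') w = genTuple N)
    (hb : multiComm w = boundaryWord N) (f : Tuple N G → Tuple N G)
    (hf : ∀ t, mapTuple (tupleHom t) w = f t) :
    ∃ φ : MapBdry N, ∀ t : Tuple N G, actTuple φ.1 t = f t := by
  have e1 : (tupleHom w).comp (tupleHom w') = MonoidHom.id _ := by
    rw [← tupleHom_mapTuple, h1, tupleHom_gen]
  have e2 : (tupleHom w').comp (tupleHom w) = MonoidHom.id _ := by
    rw [← tupleHom_mapTuple, h2, tupleHom_gen]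
  let e : MulAut (FreeSurf N) := MonoidHom.toMulEquiv (tupleHom w) (tupleHom w') e2 e1
  have he : e ∈ MapBdry N := by
    change tupleHom w (boundaryWord N) = boundaryWord N
    rw [← multiComm_eq, hb]
  refine ⟨⟨e⁻¹, (MapBdry N).inv_mem he⟩, fun t => ?_⟩
  rw [← hf, actTuple, inv_inv]
  conv_rhs => rw [← mapTuple_tupleHom_gen w]
  rfl

/-- A family of invertible word operations that preserve the multi-commutator is the action of
an element of `Map_{N,1}`. -/
theorem exists_of_natural (X Y : Tuple N (FreeSurf N) → Tuple N (FreeSurf N))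
    (f : Tuple N G → Tuple N G)
    (hX : ∀ (ψ : FreeSurf N →* FreeSurf N) t, mapTuple ψ (X t) = X (mapTuple ψ t))
    (hY : ∀ (ψ : FreeSurf N →* FreeSurf N) t, mapTuple ψ (Y t) = Y (mapTuple ψ t))
    (hf : ∀ (ψ : FreeSurf N →* G) t, mapTuple ψ (X t) = f (mapTuple ψ t))
    (hXY : ∀ t, X (Y t) = t) (hYX : ∀ t, Y (X t) = t)
    (hm : ∀ t, multiComm (X t) = multiComm t) :
    ∃ φ : MapBdry N, ∀ t : Tuple N G, actTuple φ.1 t = f t := by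
  refine exists_mapBdry (X (genTuple N)) (Y (genTuple N)) ?_ ?_ (hm _) f fun t => ?_
  · rw [hY, mapTuple_tupleHom_gen, hYX]
  · rw [hX, mapTuple_tupleHom_gen, hXY]
  · rw [hf, mapTuple_tupleHom_gen]

theorem mapTuple_update {H : Type*} [Group H] (ψ : G →* H) (t : Tuple N G) (i : Fin N)
    (p : G × G) :
    mapTuple ψ (Function.update t i p) = Function.update (mapTuple ψ t) i (ψ p.1, ψ p.2) := by
  funext l
  by_cases hl : l = i
  · subst hl; simp [mapTuple]
  · simp [mapTuple, hl]

theorem exists_moveT (i : Fin N) :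
    ∃ φ : MapBdry N, ∀ t : Tuple N G, actTuple φ.1 t = moveT i t := by
  refine exists_of_natural (moveT i)
    (fun t => Function.update t i ((t i).1, (t i).1 * (t i).2)) _ ?_ ?_ ?_ ?_ ?_ ?_
  · intro ψ t; simp [moveT, mapTuple_update, mapTuple]
  · intro ψ t; simp [mapTuple_update, mapTuple]
  · intro ψ t; simp [moveT, mapTuple_update, mapTuple]
  · intro t; simp [moveT]
  · intro t; simp [moveT]
  · intro t
    refine multiComm_update _ _ _ ?_
    simp only [pairComm]; group

theorem exists_moveS (i : Fin N) :
    ∃ φ : MapBdry N, ∀ t : Tuple N G, actTuple φ.1 t = moveS i t := by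
  refine exists_of_natural (moveS i)
    (fun t => Function.update t i ((t i).1⁻¹ * (t i).2 * (t i).1, (t i).1⁻¹)) _ ?_ ?_ ?_ ?_ ?_ ?_
  · intro ψ t; simp [moveS, mapTuple_update, mapTuple]
  · intro ψ t; simp [mapTuple_update, mapTuple]
  · intro ψ t; simp [moveS, mapTuple_update, mapTuple]
  · intro t; simp [moveS, mul_assoc]
  · intro t; simp [moveS, mul_assoc]
  · intro t
    refine multiComm_update _ _ _ ?_
    simp only [pairComm]; group

theorem exists_moveU (i : Fin N) :
    ∃ φ : MapBdry N, ∀ t : Tuple N G, actTuple φ.1 t = moveU i t := by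
  refine exists_of_natural (moveU i)
    (fun t => Function.update t i ((t i).2⁻¹ * (t i).1, (t i).2)) _ ?_ ?_ ?_ ?_ ?_ ?_
  · intro ψ t; simp [moveU, mapTuple_update, mapTuple]
  · intro ψ t; simp [mapTuple_update, mapTuple]
  · intro ψ t; simp [moveU, mapTuple_update, mapTuple]
  · intro t; simp [moveU]
  · intro t; simp [moveU]
  · intro t
    refine multiComm_update _ _ _ ?_
    simp only [pairComm]; group

theorem mapTuple_moveL {H : Type*} [Group H] (ψ : G →* H) (i j : Fin N) (t : Tuple N G) :
    mapTuple ψ (moveL i j t) = moveL i j (mapTuple ψ t) := by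
  funext l
  by_cases hl : l = i
  · simp [mapTuple, moveL, hl]
  · by_cases hl' : l = j
    · subst hl'
      simp [mapTuple, moveL, hl]
    · simp [mapTuple, moveL, hl, hl']

/-- The inverse of `moveL`. -/
def moveLInv (i j : Fin N) (t : Tuple N G) : Tuple N G :=
  let g := (t i).1
  let x := (t i).2
  let h := (t j).1
  let y := (t j).2
  let k := h * (x⁻¹ * g * x) * h⁻¹
  fun l => if l = i then (g, x * h⁻¹ * k)
    else if l = j then (k⁻¹ * h * k, k⁻¹ * h * y) else t l

theorem mapTuple_moveLInv {H : Type*} [Group H] (ψ : G →* H) (i j : Fin N) (t : Tuple N G) :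
    mapTuple ψ (moveLInv i j t) = moveLInv i j (mapTuple ψ t) := by
  funext l
  by_cases hl : l = i
  · simp [mapTuple, moveLInv, hl]
  · by_cases hl' : l = j
    · subst hl'
      simp [mapTuple, moveLInv, hl]
    · simp [mapTuple, moveLInv, hl, hl']

theorem exists_moveL (i j : Fin N) (hij : (j : ℕ) = i + 1) :
    ∃ φ : MapBdry N, ∀ t : Tuple N G, actTuple φ.1 t = moveL i j t := by
  have hne : j ≠ i := fun h => by rw [h] at hij; omega
  refine exists_of_natural (moveL i j) (moveLInv i j) _
    (fun ψ t => mapTuple_moveL ψ i j t) (fun ψ t => mapTuple_moveLInv ψ i j t)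
    (fun ψ t => mapTuple_moveL ψ i j t) ?_ ?_ ?_
  · intro t
    funext l
    by_cases hl : l = i
    · subst hl
      simp only [moveL, moveLInv, if_true, hne, if_false]
      refine Prod.ext rfl ?_
      dsimp only; group
    · by_cases hl' : l = j
      · subst hl'
        simp only [moveL, moveLInv, if_true, hne, if_false]
        refine Prod.ext ?_ ?_ <;> dsimp only <;> group
      · simp [moveL, moveLInv, hl, hl']
  · intro t
    funext l
    by_cases hl : l = i
    · subst hl
      simp only [moveL, moveLInv, if_true, hne, if_false]
      refine Prod.ext rfl ?_
      dsimp only; group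
    · by_cases hl' : l = j
      · subst hl'
        simp only [moveL, moveLInv, if_true, hne, if_false]
        refine Prod.ext ?_ ?_ <;> dsimp only <;> group
      · simp [moveL, moveLInv, hl, hl']
  · intro t
    refine multiComm_pair i j hij _ _ (fun l h1 h2 => by simp [moveL, h1, h2]) ?_
    simp only [moveL, if_true, hne, if_false, pairComm]
    group

theorem tailTuple_moveM (i : Fin N) (t : Tuple N G) :
    tailTuple i (moveM i t) = mapTuple (MulAut.conj
      ((t i).2⁻¹ * (t i).1 * (t i).2 * multiComm (tailTuple i t))).toMonoidHom
      (tailTuple i t) := by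
  funext l
  by_cases hl : i < l
  · simp [tailTuple, moveM, mapTuple, hl, hl.ne', mul_assoc]
  · simp [tailTuple, mapTuple, hl]

/-- The inverse of `moveM`. -/
def moveMInv (i : Fin N) (t : Tuple N G) : Tuple N G :=
  let g := (t i).1
  let x := (t i).2
  let c := x⁻¹ * g * x * multiComm (tailTuple i t)
  fun l => if l = i then (g, x * c)
    else if i < l then (c⁻¹ * (t l).1 * c, c⁻¹ * (t l).2 * c) else t l

theorem tailTuple_moveMInv (i : Fin N) (t : Tuple N G) :
    tailTuple i (moveMInv i t) = mapTuple (MulAut.conj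
      ((t i).2⁻¹ * (t i).1 * (t i).2 * multiComm (tailTuple i t))⁻¹).toMonoidHom
      (tailTuple i t) := by
  funext l
  by_cases hl : i < l
  · simp [tailTuple, moveMInv, mapTuple, hl, hl.ne', mul_assoc]
  · simp [tailTuple, mapTuple, hl]

theorem mapTuple_tailTuple {H : Type*} [Group H] (ψ : G →* H) (i : Fin N) (t : Tuple N G) :
    mapTuple ψ (tailTuple i t) = tailTuple i (mapTuple ψ t) := by
  funext l
  by_cases hl : i < l <;> simp [tailTuple, mapTuple, hl]

theorem mapTuple_moveM {H : Type*} [Group H] (ψ : G →* H) (i : Fin N) (t : Tuple N G) :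
    mapTuple ψ (moveM i t) = moveM i (mapTuple ψ t) := by
  have hc := multiComm_map ψ (tailTuple i t)
  rw [mapTuple_tailTuple] at hc
  funext l
  simp only [moveM, hc]
  by_cases hl : l = i
  · simp [mapTuple, hl]
  · by_cases hl' : i < l <;> simp [mapTuple, hl, hl']

theorem mapTuple_moveMInv {H : Type*} [Group H] (ψ : G →* H) (i : Fin N) (t : Tuple N G) :
    mapTuple ψ (moveMInv i t) = moveMInv i (mapTuple ψ t) := by
  have hc := multiComm_map ψ (tailTuple i t)
  rw [mapTuple_tailTuple] at hc
  funext l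
  simp only [moveMInv, hc]
  by_cases hl : l = i
  · simp [mapTuple, hl]
  · by_cases hl' : i < l <;> simp [mapTuple, hl, hl']

theorem exists_moveM (i : Fin N) :
    ∃ φ : MapBdry N, ∀ t : Tuple N G, actTuple φ.1 t = moveM i t := by
  refine exists_of_natural (moveM i) (moveMInv i) _
    (fun ψ t => mapTuple_moveM ψ i t) (fun ψ t => mapTuple_moveMInv ψ i t)
    (fun ψ t => mapTuple_moveM ψ i t) ?_ ?_ ?_
  · intro t
    have h := tailTuple_moveMInv i t
    set c := (t i).2⁻¹ * (t i).1 * (t i).2 * multiComm (tailTuple i t) with hc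
    have hi : moveMInv i t i = ((t i).1, (t i).2 * c) := by simp [moveMInv, hc]
    have h2 : ((t i).2 * c)⁻¹ * (t i).1 * ((t i).2 * c) *
        multiComm (tailTuple i (moveMInv i t)) = c := by
      rw [h, multiComm_map]
      simp only [MulEquiv.toMonoidHom_eq_coe, MonoidHom.coe_coe, MulAut.conj_apply]
      rw [hc]; group
    funext l
    rw [moveM, hi]
    simp only [h2]
    by_cases hl : l = i
    · subst hl; simp
    · by_cases hl' : i < l
      · simp only [hl, hl', if_true, if_false, moveMInv, ← hc]
        refine Prod.ext ?_ ?_ <;> dsimp only <;> group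
      · simp [hl, hl', moveMInv]
  · intro t
    have h := tailTuple_moveM i t
    set c := (t i).2⁻¹ * (t i).1 * (t i).2 * multiComm (tailTuple i t) with hc
    have hi : moveM i t i = ((t i).1, (t i).2 * c⁻¹) := by simp [moveM, hc]
    have h2 : ((t i).2 * c⁻¹)⁻¹ * (t i).1 * ((t i).2 * c⁻¹) *
        multiComm (tailTuple i (moveM i t)) = c := by
      rw [h, multiComm_map]
      simp only [MulEquiv.toMonoidHom_eq_coe, MonoidHom.coe_coe, MulAut.conj_apply]
      rw [hc]; group
    funext l
    rw [moveMInv, hi]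
    simp only [h2]
    by_cases hl : l = i
    · subst hl; simp
    · by_cases hl' : i < l
      · simp only [hl, hl', if_true, if_false, moveM, ← hc]
        refine Prod.ext ?_ ?_ <;> dsimp only <;> group
      · simp [hl, hl', moveM]
  · intro t
    refine multiComm_tail i _ _ (fun l hl => by simp [moveM, hl.ne, hl.not_gt]) ?_
    rw [tailTuple_moveM, multiComm_map]
    simp only [moveM, if_true, pairComm, MulEquiv.toMonoidHom_eq_coe, MonoidHom.coe_coe,
      MulAut.conj_apply]
    group

end Generators

/-! ## Tuples of powers of one element -/

/-- The tuple `((g^{m₁}|g^{n₁}),…,(g^{m_N}|g^{n_N}))`, where `m_i = v (inl i)` and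
`n_i = v (inr i)`. -/
def powerTuple {N : ℕ} {G : Type*} [Group G] (g : G) (v : Fin N ⊕ Fin N → ℤ) : Tuple N G :=
  fun i => (g ^ v (Sum.inl i), g ^ v (Sum.inr i))

theorem multiComm_powerTuple {N : ℕ} {G : Type*} [Group G] (g : G) (v : Fin N ⊕ Fin N → ℤ) :
    multiComm (powerTuple g v) = 1 := by
  have h : ∀ i, pairComm (powerTuple g v i) = 1 := by
    intro i
    simp only [pairComm, powerTuple, ← zpow_neg, ← zpow_add]
    ring_nf
    exact zpow_zero g
  simp [multiComm, h]

/-- The `2N`-conjugacy class of a tuple of powers of `g`. -/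
def powerClass {N : ℕ} {G : Type*} [Group G] (g : G) (v : Fin N ⊕ Fin N → ℤ) :
    FlatClass N G :=
  ⟨classOf (powerTuple g v), congrArg ConjClasses.mk (multiComm_powerTuple g v)⟩

/-- The set of `2N`-conjugacy classes of tuples of powers of `g`. -/
def powerClasses (N : ℕ) {G : Type*} [Group G] (g : G) : Set (FlatClass N G) :=
  Set.range (powerClass (N := N) g)

/-- `gcd(m₁,…,m_N,n₁,…,n_N,o(g))`. -/
noncomputable def expGcd {N : ℕ} {G : Type*} [Group G] (g : G) (v : Fin N ⊕ Fin N → ℤ) : ℕ :=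
  Nat.gcd (Finset.univ.gcd fun k => (v k).natAbs) (orderOf g)

/-! ## The symplectic representation -/

/-- The exponent sum of the `l`-th generator in a word. -/
def exponentSum {N : ℕ} (l : Fin N ⊕ Fin N) : FreeSurf N →* Multiplicative ℤ :=
  FreeGroup.lift fun k => Multiplicative.ofAdd (if k = l then 1 else 0)

/-- The matrix by which a mapping class `φ` acts, via `f ↦ f ∘ φ⁻¹`, on the first cohomology
group `Hom(π₁, ℤ) ≅ ℤ^{2N}` of the surface, written in the basis dual to the standard
generators. By Poincaré duality this is the action on first homology. -/
def homologyMatrix {N : ℕ} (φ : MapBdry N) : Matrix (Fin N ⊕ Fin N) (Fin N ⊕ Fin N) ℤ :=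
  Matrix.of fun k l => (exponentSum l ((φ⁻¹).1 (FreeGroup.of k))).toAdd

/-- The orbit of a vector under the defining action of `Sp(2N, R)` on `R^{2N}`. -/
def spOrbit {N : ℕ} {R : Type*} [CommRing R] (z : Fin N ⊕ Fin N → R) :
    Set (Fin N ⊕ Fin N → R) :=
  {w | ∃ A : Matrix.symplecticGroup (Fin N) R, A.1.mulVec z = w}

end MCG

namespace MCG

/-! A homomorphism from the free group to `⟨g⟩` factors through the abelianization `ℤ^{2N}`, so
`Map_{N,1}` acts on tuples of powers of `g` by applying an integral matrix to the exponent vector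
(`actTuple_powerTuple`). This matrix is symplectic: a homomorphism to the Heisenberg group that
lifts two exponent sums sends the boundary word to their symplectic pairing, placed in the centre,
and mapping classes fix the boundary word (`homologyMatrix_mem`). The matrix action descends to
conjugacy classes of tuples because conjugation by one element is compatible with integral linear
combinations of exponents (`powerClass_mulVec_congr`).

For transitivity, the moves `T`, `U`, `S`, `L` act on exponents by elementary operations. The
Euclidean algorithm, inside each handle and between neighbouring handles, leads to a tuple whose
only possibly nontrivial entry is the first one, `g^e`. Since `1 = g^{o(g)}`, one more Euclidean
reduction replaces `e` by `gcd(e, o(g))`, which is `γ(v)` (`powerRel_normalForm`).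

Conversely, integral matrices preserve common divisors of the exponents and `o(g)`
(`expGcd_dvd_of_modEq`). If distinct elements of `⟨g⟩` are not conjugate, a class determines its
exponents modulo `o(g)`, so `γ` is a complete invariant of orbits. As `Sp(2N, ℤ/o(g))` preserves `γ`
too, its orbits match those of `Map_N`, and surjectivity of reduction from `Sp(2N, ℤ)` is not needed
(`mapOrbit_powerClassMod`). -/

/-! ## The integral Heisenberg group -/

/-- The integral Heisenberg group, in coordinates `(x, y, z)` with `z` central. -/
@[ext]
structure Heisenberg where
  x : ℤ
  y : ℤ
  z : ℤ

namespace Heisenberg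

/-- The product is that of upper unitriangular 3×3 matrices with `x`, `y` next to the diagonal and
`z` in the corner. -/
instance : Group Heisenberg where
  mul p q := ⟨p.x + q.x, p.y + q.y, p.z + q.z + p.x * q.y⟩
  one := ⟨0, 0, 0⟩
  inv p := ⟨-p.x, -p.y, -p.z + p.x * p.y⟩
  mul_assoc p q r := by
    ext
    · exact add_assoc _ _ _
    · exact add_assoc _ _ _
    · change p.z + q.z + p.x * q.y + r.z + (p.x + q.x) * r.y =
        p.z + (q.z + r.z + q.x * r.y) + p.x * (q.y + r.y)
      ring
  one_mul p := by
    ext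
    · exact zero_add _
    · exact zero_add _
    · change 0 + p.z + 0 * p.y = p.z
      ring
  mul_one p := by
    ext
    · exact add_zero _
    · exact add_zero _
    · change p.z + 0 + p.x * 0 = p.z
      ring
  inv_mul_cancel p := by
    ext
    · exact neg_add_cancel _
    · exact neg_add_cancel _
    · change -p.z + p.x * p.y + p.z + -p.x * p.y = 0
      ring

@[simp] theorem mul_x (p q : Heisenberg) : (p * q).x = p.x + q.x := rfl
@[simp] theorem mul_y (p q : Heisenberg) : (p * q).y = p.y + q.y := rfl
@[simp] theorem mul_z (p q : Heisenberg) : (p * q).z = p.z + q.z + p.x * q.y := rfl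
@[simp] theorem inv_x (p : Heisenberg) : p⁻¹.x = -p.x := rfl
@[simp] theorem inv_y (p : Heisenberg) : p⁻¹.y = -p.y := rfl
@[simp] theorem inv_z (p : Heisenberg) : p⁻¹.z = -p.z + p.x * p.y := rfl

/-- The first coordinate, as a homomorphism. -/
def xHom : Heisenberg →* Multiplicative ℤ where
  toFun p := Multiplicative.ofAdd p.x
  map_one' := rfl
  map_mul' _ _ := rfl

/-- The second coordinate, as a homomorphism. -/
def yHom : Heisenberg →* Multiplicative ℤ where
  toFun p := Multiplicative.ofAdd p.y
  map_one' := rfl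
  map_mul' _ _ := rfl

/-- The group is nilpotent of class two, so a commutator is central and depends only on the images
in `ℤ²`, through their determinant. -/
theorem pairComm_eq (p : Heisenberg × Heisenberg) :
    pairComm p = ⟨0, 0, p.1.x * p.2.y - p.2.x * p.1.y⟩ := by
  ext
  · simp [pairComm]
  · simp [pairComm]
  · simp only [pairComm, mul_x, mul_z, inv_x, inv_y, inv_z]
    ring

/-- The multi-commutator in the Heisenberg group is the standard symplectic form of the
`x`-coordinates and the `y`-coordinates. -/
theorem multiComm_eq_sum {N : ℕ} (t : Tuple N Heisenberg) :
    multiComm t = ⟨0, 0, ∑ i, ((t i).1.x * (t i).2.y - (t i).2.x * (t i).1.y)⟩ := by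
  induction N with
  | zero => simp [multiComm]; rfl
  | succ n ih =>
    rw [multiComm_succ, ih, pairComm_eq, Fin.sum_univ_succ]
    ext <;> simp

end Heisenberg

/-! ## Exponent sums -/

theorem exponentSum_of {N : ℕ} (l k : Fin N ⊕ Fin N) :
    (exponentSum l (FreeGroup.of k)).toAdd = if k = l then 1 else 0 := by
  simp [exponentSum]

/-- A homomorphism with all values powers of `g` is determined by exponent sums. -/
theorem lift_zpow_apply {N : ℕ} {G : Type*} [Group G] (g : G) (v : Fin N ⊕ Fin N → ℤ)
    (x : FreeSurf N) :
    FreeGroup.lift (fun k => g ^ v k) x = g ^ ∑ l, (exponentSum l x).toAdd * v l := by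
  induction x using FreeGroup.induction_on with
  | C1 => simp
  | of k => simp [exponentSum_of]
  | inv_of k _ => simp [exponentSum_of]
  | mul x y hx hy =>
    simp only [map_mul, hx, hy, toAdd_mul, add_mul, Finset.sum_add_distrib, zpow_add]

/-- The chain rule for abelianized endomorphisms: `lift_zpow_apply` for the generator of the
infinite cyclic group. -/
theorem exponentSum_comp {N : ℕ} (f : FreeSurf N →* FreeSurf N) (l : Fin N ⊕ Fin N)
    (x : FreeSurf N) :
    (exponentSum l (f x)).toAdd =
      ∑ j, (exponentSum j x).toAdd * (exponentSum l (f (FreeGroup.of j))).toAdd := by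
  have h := lift_zpow_apply (Multiplicative.ofAdd (1 : ℤ))
    (fun j => (exponentSum l (f (FreeGroup.of j))).toAdd) x
  have h2 : FreeGroup.lift (fun j => Multiplicative.ofAdd (1 : ℤ) ^
      (exponentSum l (f (FreeGroup.of j))).toAdd) = (exponentSum l).comp f := by
    ext k
    simp [← ofAdd_zsmul]
  rw [h2] at h
  have h3 := congrArg Multiplicative.toAdd h
  simpa [← ofAdd_zsmul, mul_comm] using h3

/-! ### The symplectic representation. -/

theorem homologyMatrix_one (N : ℕ) : homologyMatrix (1 : MapBdry N) = 1 := by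
  ext k l
  change (exponentSum l (FreeGroup.of k)).toAdd = _
  rw [exponentSum_of, Matrix.one_apply]

/-- Inversion reverses the order of the factors, and recording the images of generators as rows
reverses it again, so the result is a homomorphism. -/
theorem homologyMatrix_mul {N : ℕ} (φ ψ : MapBdry N) :
    homologyMatrix (φ * ψ) = homologyMatrix φ * homologyMatrix ψ := by
  ext k l
  rw [Matrix.mul_apply]
  have h : ((φ * ψ)⁻¹).1 (FreeGroup.of k) = (ψ⁻¹).1 ((φ⁻¹).1 (FreeGroup.of k)) := by
    rw [mul_inv_rev]; rfl
  simp only [homologyMatrix, Matrix.of_apply, h]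
  exact exponentSum_comp (ψ⁻¹).1.toMonoidHom l _

/-- The homomorphism to the Heisenberg group that lifts a pair of exponent sums. -/
def heisenbergHom {N : ℕ} (l m : Fin N ⊕ Fin N) : FreeSurf N →* Heisenberg :=
  FreeGroup.lift fun k => ⟨if k = l then 1 else 0, if k = m then 1 else 0, 0⟩

theorem heisenbergHom_x {N : ℕ} (l m : Fin N ⊕ Fin N) (w : FreeSurf N) :
    (heisenbergHom l m w).x = (exponentSum l w).toAdd := by
  have h : Heisenberg.xHom.comp (heisenbergHom l m) = exponentSum l := by
    ext k
    simp [heisenbergHom, exponentSum, Heisenberg.xHom]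
  exact congrArg Multiplicative.toAdd (DFunLike.congr_fun h w)

theorem heisenbergHom_y {N : ℕ} (l m : Fin N ⊕ Fin N) (w : FreeSurf N) :
    (heisenbergHom l m w).y = (exponentSum m w).toAdd := by
  have h : Heisenberg.yHom.comp (heisenbergHom l m) = exponentSum m := by
    ext k
    simp [heisenbergHom, exponentSum, Heisenberg.yHom]
  exact congrArg Multiplicative.toAdd (DFunLike.congr_fun h w)

/-- The overall sign comes from the convention that `Matrix.J` has `-1` in its upper right block. -/
theorem transpose_mul_J_mul_apply {N : ℕ} (A : Matrix (Fin N ⊕ Fin N) (Fin N ⊕ Fin N) ℤ)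
    (l m : Fin N ⊕ Fin N) :
    (A.transpose * Matrix.J (Fin N) ℤ * A) l m =
      -∑ i, (A (Sum.inl i) l * A (Sum.inr i) m - A (Sum.inr i) l * A (Sum.inl i) m) := by
  have h : ∀ j : Fin N ⊕ Fin N, (A.transpose * Matrix.J (Fin N) ℤ) l j =
      Sum.elim (fun i => A (Sum.inr i) l) (fun i => -A (Sum.inl i) l) j := by
    rintro (j | j) <;>
      simp [Matrix.mul_apply, Matrix.J, Fintype.sum_sum_type, Matrix.one_apply]
  rw [Matrix.mul_apply, Fintype.sum_sum_type]
  simp only [h, Sum.elim_inl, Sum.elim_inr, Finset.sum_sub_distrib, neg_mul,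
    Finset.sum_neg_distrib]
  ring

/-- A mapping class acts on homology by a symplectic matrix. -/
theorem homologyMatrix_mem {N : ℕ} (φ : MapBdry N) :
    homologyMatrix φ ∈ Matrix.symplecticGroup (Fin N) ℤ := by
  have key : ∀ (l m : Fin N ⊕ Fin N) (ψ : MapBdry N),
      (multiComm (mapTuple ((heisenbergHom l m).comp (ψ⁻¹).1.toMonoidHom) (genTuple N))).z =
        -((homologyMatrix ψ).transpose * Matrix.J (Fin N) ℤ * homologyMatrix ψ) l m := by
    intro l m ψ
    rw [transpose_mul_J_mul_apply, Heisenberg.multiComm_eq_sum, neg_neg]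
    simp only [mapTuple, genTuple, MonoidHom.comp_apply, heisenbergHom_x, heisenbergHom_y]
    rfl
  -- The left side does not depend on `ψ`, since `ψ⁻¹` fixes the boundary word.
  have hb : ∀ (l m : Fin N ⊕ Fin N) (ψ : MapBdry N),
      multiComm (mapTuple ((heisenbergHom l m).comp (ψ⁻¹).1.toMonoidHom) (genTuple N)) =
        heisenbergHom l m (boundaryWord N) := by
    intro l m ψ
    rw [multiComm_map]
    exact congrArg (heisenbergHom l m) (mapBdry_boundary ψ⁻¹)
  rw [SymplecticGroup.mem_iff']
  ext l m
  have h := key l m φ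
  -- Comparison with the identity, whose matrix is `1`, eliminates the value on the boundary word.
  have h1 := key l m 1
  rw [hb] at h h1
  rw [h, homologyMatrix_one] at h1
  simpa using h1

/-- Commutators vanish in an abelian group. Hence exponent sums are defined on the closed surface
group. -/
theorem exponentSum_boundaryWord {N : ℕ} (l : Fin N ⊕ Fin N) :
    exponentSum l (boundaryWord N) = 1 := by
  rw [boundaryWord, ← multiComm_map]
  have h : ∀ p : Multiplicative ℤ × Multiplicative ℤ, pairComm p = 1 := by
    intro p
    rw [pairComm, mul_assoc, mul_comm p.1, ← mul_inv_rev, mul_comm p.2, inv_mul_cancel]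
  simp [multiComm, h]

/-- Homomorphisms to an abelian group do not see inner automorphisms of the closed surface group. -/
theorem homologyMatrix_of_mem_capKernel {N : ℕ} {φ : MapBdry N} (hφ : φ ∈ capKernel N) :
    homologyMatrix φ = 1 := by
  obtain ⟨c, hc⟩ := (capKernel N).inv_mem hφ
  ext k l
  let r : SurfaceGroup N →* Multiplicative ℤ := PresentedGroup.toGroup
    (f := fun k => Multiplicative.ofAdd (if k = l then (1 : ℤ) else 0)) (by
      rintro r rfl
      exact exponentSum_boundaryWord l)
  have hr : ∀ x, r (PresentedGroup.mk {boundaryWord N} x) = exponentSum l x := fun _ => rfl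
  have h := congrArg r (hc (FreeGroup.of k))
  rw [map_mul, map_mul, map_inv, mul_inv_cancel_comm, hr, hr] at h
  rw [homologyMatrix, Matrix.of_apply, h, exponentSum_of, Matrix.one_apply]

/-- The symplectic representation of the mapping class group of the surface with boundary. -/
def symplecticRepBdry (N : ℕ) : MapBdry N →* Matrix.symplecticGroup (Fin N) ℤ where
  toFun φ := ⟨homologyMatrix φ, homologyMatrix_mem φ⟩
  map_one' := Subtype.ext (homologyMatrix_one N)
  map_mul' φ ψ := Subtype.ext (homologyMatrix_mul φ ψ)

/-- The symplectic representation of the mapping class group of the closed surface. -/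
def symplecticRep (N : ℕ) : MapClosed N →* Matrix.symplecticGroup (Fin N) ℤ :=
  QuotientGroup.lift (capKernel N) (symplecticRepBdry N) fun _ hφ =>
    Subtype.ext (homologyMatrix_of_mem_capKernel hφ)

/-! ## The action on tuples of powers -/

theorem tupleHom_powerTuple {N : ℕ} {G : Type*} [Group G] (g : G) (v : Fin N ⊕ Fin N → ℤ)
    (x : FreeSurf N) :
    tupleHom (powerTuple g v) x = g ^ ∑ l, (exponentSum l x).toAdd * v l := by
  rw [← lift_zpow_apply]
  have h : tupleHom (powerTuple g v) = FreeGroup.lift (fun k => g ^ v k) := by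
    ext k
    rcases k with k | k <;> simp [tupleHom, powerTuple]
  rw [h]

theorem actTuple_powerTuple {N : ℕ} {G : Type*} [Group G] (g : G) (φ : MapBdry N)
    (v : Fin N ⊕ Fin N → ℤ) :
    actTuple φ.1 (powerTuple g v) = powerTuple g ((homologyMatrix φ).mulVec v) := by
  funext i
  exact Prod.ext (tupleHom_powerTuple g v _) (tupleHom_powerTuple g v _)

theorem sigma_mk_powerClass {N : ℕ} {G : Type*} [Group G] (g : G) (φ : MapBdry N)
    (v : Fin N ⊕ Fin N → ℤ) :
    sigma N G (QuotientGroup.mk φ) (powerClass g v) =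
      powerClass g ((homologyMatrix φ).mulVec v) :=
  Subtype.ext (congrArg classOf (actTuple_powerTuple g φ v))

theorem powerClass_eq_iff {N : ℕ} {G : Type*} [Group G] {g : G} {v w : Fin N ⊕ Fin N → ℤ} :
    powerClass g v = powerClass g w ↔ ∃ c : G, ∀ k, c * g ^ w k * c⁻¹ = g ^ v k := by
  refine Subtype.ext_iff.trans (classOf_eq_iff.trans ?_)
  constructor
  · rintro ⟨c, hc⟩
    rw [smul_eq_mapTuple] at hc
    refine ⟨ConjAct.ofConjAct c, ?_⟩
    rintro (k | k)
    · exact congrArg Prod.fst (congrFun hc k)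
    · exact congrArg Prod.snd (congrFun hc k)
  · rintro ⟨c, hc⟩
    refine ⟨ConjAct.toConjAct c, ?_⟩
    rw [smul_eq_mapTuple]
    funext k
    exact Prod.ext (hc (Sum.inl k)) (hc (Sum.inr k))

/-- The element that conjugates all `g ^ w l` to `g ^ v l` simultaneously also conjugates products
of their powers. This makes the matrix action well defined even if different powers of `g` are
conjugate in `G`. -/
theorem powerClass_mulVec_congr {N : ℕ} {G : Type*} [Group G] {g : G}
    {v w : Fin N ⊕ Fin N → ℤ} (A : Matrix (Fin N ⊕ Fin N) (Fin N ⊕ Fin N) ℤ)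
    (h : powerClass g v = powerClass g w) :
    powerClass g (A.mulVec v) = powerClass g (A.mulVec w) := by
  rw [powerClass_eq_iff] at h ⊢
  obtain ⟨c, hc⟩ := h
  refine ⟨c, fun k => ?_⟩
  have hs : ∀ s : Finset (Fin N ⊕ Fin N),
      c * g ^ (∑ l ∈ s, A k l * w l) * c⁻¹ = g ^ ∑ l ∈ s, A k l * v l := by
    intro s
    induction s using Finset.cons_induction with
    | empty => simp
    | cons l s hl ih =>
      rw [Finset.sum_cons, Finset.sum_cons, zpow_add, zpow_add, ← ih, mul_comm (A k l),
        mul_comm (A k l), zpow_mul, zpow_mul, ← hc l, conj_zpow]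
      group
  exact hs Finset.univ

/-- The action of integral matrices on classes of tuples of powers of `g`. -/
noncomputable def matrixAct {N : ℕ} {G : Type*} [Group G] (g : G)
    (A : Matrix (Fin N ⊕ Fin N) (Fin N ⊕ Fin N) ℤ) (d : powerClasses N g) :
    powerClasses N g :=
  ⟨powerClass g (A.mulVec d.2.choose), Set.mem_range_self _⟩

/-- The exponent vector chosen in `matrixAct` may differ from `v`, but it represents the same class.
-/
theorem matrixAct_mk {N : ℕ} {G : Type*} [Group G] (g : G)
    (A : Matrix (Fin N ⊕ Fin N) (Fin N ⊕ Fin N) ℤ) (v : Fin N ⊕ Fin N → ℤ) :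
    matrixAct g A ⟨powerClass g v, Set.mem_range_self v⟩ =
      ⟨powerClass g (A.mulVec v), Set.mem_range_self _⟩ :=
  Subtype.ext (powerClass_mulVec_congr A (Exists.choose_spec (Set.mem_range_self v)))

/-- The action of the symplectic group on classes of tuples of powers of `g`. -/
noncomputable def symplecticAct (N : ℕ) {G : Type*} [Group G] (g : G) :
    Matrix.symplecticGroup (Fin N) ℤ →* Equiv.Perm (powerClasses N g) :=
  MonoidHom.toHomPerm
    { toFun := fun A => (matrixAct g A.1 : Function.End (powerClasses N g))
      map_one' := by
        funext ⟨d, v, hv⟩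
        subst hv
        rw [matrixAct_mk]
        simp only [OneMemClass.coe_one, Matrix.one_mulVec]
        rfl
      map_mul' := by
        intro A B
        funext ⟨d, v, hv⟩
        subst hv
        refine (matrixAct_mk g _ v).trans (Eq.symm ?_)
        refine (congrArg (matrixAct g A.1) (matrixAct_mk g B.1 v)).trans ?_
        rw [matrixAct_mk]
        simp only [Submonoid.coe_mul, Matrix.mulVec_mulVec] }

theorem symplecticAct_mk {N : ℕ} {G : Type*} [Group G] (g : G)
    (A : Matrix.symplecticGroup (Fin N) ℤ) (v : Fin N ⊕ Fin N → ℤ) :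
    symplecticAct N g A ⟨powerClass g v, Set.mem_range_self v⟩ =
      ⟨powerClass g (A.1.mulVec v), Set.mem_range_self _⟩ :=
  matrixAct_mk g A.1 v

theorem sigma_eq_symplecticAct {N : ℕ} {G : Type*} [Group G] (g : G) (φ : MapClosed N)
    (d : powerClasses N g) :
    sigma N G φ d.1 = (symplecticAct N g (symplecticRep N φ) d).1 := by
  obtain ⟨d, v, rfl⟩ := d
  obtain ⟨φ, rfl⟩ := QuotientGroup.mk_surjective φ
  rw [sigma_mk_powerClass, symplecticAct_mk]
  rfl

/-! ## Reduction of tuples of powers -/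

/-- The Euclidean algorithm for an equivalence relation that is invariant under elementary
operations. -/
theorem euclid_reduce (r : ℤ × ℤ → ℤ × ℤ → Prop) (hr : Equivalence r)
    (h1 : ∀ a b, r (a, b) (a, b + a)) (h2 : ∀ a b, r (a, b) (a + b, b)) (a b : ℤ) :
    r (a, b) ((Int.gcd a b : ℤ), 0) := by
  -- The rotation is a product of three shears: `(a, b) ~ (a + b, b) ~ (a + b, -a) ~ (b, -a)`.
  have rot : ∀ a b, r (a, b) (b, -a) := by
    intro a b
    have e1 : r (a + b, b) (a + b, -a) := by
      have := hr.symm (h1 (a + b) (-a))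
      rwa [show -a + (a + b) = b by ring] at this
    have e2 : r (a + b, -a) (b, -a) := by
      have := h2 (a + b) (-a)
      rwa [show a + b + -a = b by ring] at this
    exact hr.trans (h2 a b) (hr.trans e1 e2)
  have hmul : ∀ (k : ℤ) (a b : ℤ), r (a, b) (a + k * b, b) := by
    intro k
    induction k using Int.induction_on with
    | zero => intro a b; simpa using hr.refl _
    | succ n ih =>
      intro a b
      have := hr.trans (ih a b) (h2 _ _)
      rwa [show a + n * b + b = a + (n + 1) * b by ring] at this
    | pred n ih =>
      intro a b
      have := h2 (a + (-n - 1) * b) b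
      rw [show a + (-n - 1) * b + b = a + -n * b by ring] at this
      exact hr.trans (ih a b) (hr.symm this)
  induction hn : b.natAbs using Nat.strong_induction_on generalizing a b with
  | _ n ih =>
    by_cases hb : b = 0
    · subst hb
      rw [Int.gcd_zero_right]
      rcases Int.natAbs_eq a with h | h
      · rw [← h]; exact hr.refl _
      -- Two rotations change the sign, which makes the remaining entry nonnegative.
      · have h3 : r (a, 0) (-a, 0) := by
          have := hr.trans (rot a 0) (rot _ _)
          simpa using this
        rwa [show ((a.natAbs : ℕ) : ℤ) = -a by omega]
    -- One division step followed by a rotation gives `(b, -(a % b))`, whose second entry is smaller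
    -- in absolute value.
    · have e1 : r (a, b) (a % b, b) := by
        have := hmul (-(a / b)) a b
        rwa [show a + -(a / b) * b = a % b by rw [Int.emod_def]; ring] at this
      have hlt : (-(a % b)).natAbs < n := by
        have h3 := Int.emod_nonneg a hb
        have h4 := Int.emod_lt_abs a hb
        rw [Int.abs_eq_natAbs] at h4
        omega
      have e2 := ih _ hlt b (-(a % b)) rfl
      rw [Int.gcd_neg, Int.gcd_comm, Int.gcd_emod] at e2
      exact hr.trans e1 (hr.trans (rot _ _) e2)

variable {N : ℕ} {G : Type*} [Group G]

/-- The tuple of powers of `g` with a given tuple of pairs of exponents. -/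
def pairPower (g : G) (u : Fin N → ℤ × ℤ) : Tuple N G := fun i => (g ^ (u i).1, g ^ (u i).2)

/-- Two tuples of pairs of exponents are related if a mapping class maps one of the corresponding
tuples of powers of `g` to the other. -/
def PowerRel (g : G) (u w : Fin N → ℤ × ℤ) : Prop :=
  ∃ φ : MapBdry N, actTuple φ.1 (pairPower g u) = pairPower g w

theorem powerRel_equivalence (g : G) : Equivalence (PowerRel (N := N) g) where
  refl u := ⟨1, actTuple_one _⟩
  symm := by
    rintro u w ⟨φ, hφ⟩
    refine ⟨φ⁻¹, ?_⟩
    rw [← hφ, ← actTuple_mul]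
    exact (congrArg (fun a => actTuple a _) (inv_mul_cancel φ.1)).trans (actTuple_one _)
  trans := by
    rintro u v w ⟨φ, hφ⟩ ⟨ψ, hψ⟩
    refine ⟨ψ * φ, ?_⟩
    rw [← hψ, ← hφ]
    exact actTuple_mul ψ.1 φ.1 _

theorem pairPower_update (g : G) (u : Fin N → ℤ × ℤ) (i : Fin N) (p : ℤ × ℤ) :
    pairPower g (Function.update u i p) =
      Function.update (pairPower g u) i (g ^ p.1, g ^ p.2) := by
  funext l
  by_cases hl : l = i
  · subst hl; simp [pairPower]
  · simp [pairPower, hl]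

theorem powerRel_add_snd (g : G) (u : Fin N → ℤ × ℤ) (i : Fin N) (a b : ℤ) :
    PowerRel g (Function.update u i (a, b)) (Function.update u i (a, b + a)) := by
  -- `moveT` subtracts the first exponent from the second, so it realizes the inverse shear.
  refine (powerRel_equivalence g).symm ?_
  obtain ⟨φ, hφ⟩ := exists_moveT (G := G) i
  refine ⟨φ, ?_⟩
  rw [hφ, pairPower_update, pairPower_update]
  simp [moveT, zpow_add, (Commute.refl g).zpow_zpow b a |>.eq]

theorem powerRel_add_fst (g : G) (u : Fin N → ℤ × ℤ) (i : Fin N) (a b : ℤ) :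
    PowerRel g (Function.update u i (a, b)) (Function.update u i (a + b, b)) := by
  obtain ⟨φ, hφ⟩ := exists_moveU (G := G) i
  refine ⟨φ, ?_⟩
  rw [hφ, pairPower_update, pairPower_update]
  simp [moveU, zpow_add, (Commute.refl g).zpow_zpow b a |>.eq]

theorem powerRel_gcd (g : G) (u : Fin N → ℤ × ℤ) (i : Fin N) (a b : ℤ) :
    PowerRel g (Function.update u i (a, b)) (Function.update u i ((Int.gcd a b : ℤ), 0)) :=
  euclid_reduce (fun p q => PowerRel g (Function.update u i p) (Function.update u i q))
    ⟨fun _ => (powerRel_equivalence g).refl _, fun h => (powerRel_equivalence g).symm h,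
      fun h h' => (powerRel_equivalence g).trans h h'⟩
    (powerRel_add_snd g u i) (powerRel_add_fst g u i) a b

theorem powerRel_rotate (g : G) (u : Fin N → ℤ × ℤ) (i : Fin N) (a b : ℤ) :
    PowerRel g (Function.update u i (a, b)) (Function.update u i (-b, a)) := by
  obtain ⟨φ, hφ⟩ := exists_moveS (G := G) i
  refine ⟨φ, ?_⟩
  rw [hφ, pairPower_update, pairPower_update]
  simp only [moveS, Function.update_self, Function.update_idem, ← zpow_neg, ← zpow_add]
  congr 3
  ring

/-- The symplectic transvection that couples two neighbouring handles. -/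
theorem powerRel_couple (g : G) (u : Fin N → ℤ × ℤ) {i j : Fin N} (hij : (j : ℕ) = i + 1)
    (a b c d : ℤ) :
    PowerRel g (Function.update (Function.update u j (c, d)) i (a, b))
      (Function.update (Function.update u j (c, d + a)) i (a, b + c)) := by
  have hne : j ≠ i := fun h => by rw [h] at hij; omega
  obtain ⟨φ, hφ⟩ := exists_moveL (G := G) i j hij
  -- On exponents `moveL` yields the extra terms `-a` and `-c`; a shear in each handle removes them.
  have h : PowerRel g (Function.update (Function.update u j (c, d)) i (a, b))
      (Function.update (Function.update u j (c, d + a - c)) i (a, b + c - a)) := by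
    refine ⟨φ, ?_⟩
    rw [hφ]
    funext l
    by_cases hl : l = i
    · subst hl
      simp only [moveL, pairPower, Function.update_self, if_true, Function.update_of_ne hne,
        ← zpow_neg, ← zpow_add]
      congr 2
      ring
    · by_cases hl' : l = j
      · subst hl'
        simp only [moveL, pairPower, Function.update_self, if_true, Function.update_of_ne hne,
          hl, if_false, ← zpow_neg, ← zpow_add]
        refine Prod.ext ?_ ?_ <;> dsimp only <;> congr 1 <;> ring
      · simp [moveL, pairPower, hl, hl']
  have h1 := powerRel_add_snd g (Function.update u j (c, d + a - c)) i a (b + c - a)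
  rw [sub_add_cancel] at h1
  have h2 := powerRel_add_snd g (Function.update u i (a, b + c)) j c (d + a - c)
  rw [sub_add_cancel, Function.update_comm hne.symm, Function.update_comm hne.symm] at h2
  exact (powerRel_equivalence g).trans h ((powerRel_equivalence g).trans h1 h2)

/-- The second of two neighbouring handles can be cleared. -/
theorem powerRel_clear (g : G) (u : Fin N → ℤ × ℤ) {i j : Fin N} (hij : (j : ℕ) = i + 1)
    (p q : ℤ × ℤ) :
    ∃ e : ℤ, PowerRel g (Function.update (Function.update u j q) i p)
      (Function.update (Function.update u j 0) i (e, 0)) := by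
  have hne : j ≠ i := fun h => by rw [h] at hij; omega
  have E := powerRel_equivalence (N := N) g
  -- Once the second exponents are zero, the Euclidean algorithm runs on the first exponents of the
  -- two handles.
  have red : ∀ a c : ℤ, PowerRel g (Function.update (Function.update u j (c, 0)) i (a, 0))
      (Function.update (Function.update u j 0) i ((Int.gcd a c : ℤ), 0)) := by
    refine euclid_reduce (fun p q => PowerRel g
      (Function.update (Function.update u j (p.2, 0)) i (p.1, 0))
      (Function.update (Function.update u j (q.2, 0)) i (q.1, 0)))
      ⟨fun _ => E.refl _, fun h => E.symm h, fun h h' => E.trans h h'⟩ ?_ ?_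
    -- With handle `j` rotated to `(0, b)`, the coupling adds `a` to `b` and leaves handle `i`
    -- unchanged.
    · intro a b
      have h1 := powerRel_rotate g (Function.update u i (a, 0)) j b 0
      have h2 := powerRel_rotate g (Function.update u i (a, 0)) j (b + a) 0
      have h3 := powerRel_couple g u hij a 0 0 b
      rw [Function.update_comm hne.symm, Function.update_comm hne.symm, neg_zero] at h1 h2
      rw [add_zero] at h3
      exact E.trans h1 (E.trans h3 (E.symm h2))
    -- Here handle `i` is rotated to `(0, a)`, so the coupling changes only that handle.
    · intro a b
      have h1 := powerRel_rotate g (Function.update u j (b, 0)) i a 0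
      have h2 := powerRel_rotate g (Function.update u j (b, 0)) i (a + b) 0
      have h3 := powerRel_couple g u hij 0 a b 0
      rw [neg_zero] at h1 h2
      rw [add_zero] at h3
      exact E.trans h1 (E.trans h3 (E.symm h2))
  obtain ⟨p1, p2⟩ := p
  obtain ⟨q1, q2⟩ := q
  have h1 := powerRel_gcd g (Function.update u j (q1, q2)) i p1 p2
  have h2 := powerRel_gcd g (Function.update u i ((Int.gcd p1 p2 : ℤ), 0)) j q1 q2
  rw [Function.update_comm hne.symm, Function.update_comm hne.symm] at h2
  exact ⟨_, E.trans h1 (E.trans h2 (red _ _))⟩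

theorem exists_powerRel_update_zero [NeZero N] (g : G) (u : Fin N → ℤ × ℤ) :
    ∃ e : ℤ, PowerRel g u (Function.update 0 0 (e, 0)) := by
  have E := powerRel_equivalence (N := N) g
  have hN : 1 ≤ N := NeZero.one_le
  have key : ∃ w, PowerRel g u w ∧ ∀ l : Fin N, 1 ≤ (l : ℕ) → w l = 0 := by
    -- Handles are cleared from the last one down to index `1`. The guard `1 ≤ j` ensures that the
    -- handle being cleared has a left neighbour.
    refine Nat.decreasingInduction (n := N)
      (motive := fun j _ => 1 ≤ j → ∃ w, PowerRel g u w ∧ ∀ l : Fin N, j ≤ (l : ℕ) → w l = 0)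
      ?_ ?_ hN le_rfl
    · intro k hk ih hk1
      obtain ⟨w, hw, hw0⟩ := ih (by omega)
      let i : Fin N := ⟨k - 1, by omega⟩
      let j : Fin N := ⟨k, hk⟩
      have hij : (j : ℕ) = i + 1 := by simp only [i, j]; omega
      obtain ⟨e, he⟩ := powerRel_clear g w hij (w i) (w j)
      rw [Function.update_eq_self, Function.update_eq_self] at he
      refine ⟨_, E.trans hw he, fun l hl => ?_⟩
      have hli : l ≠ i := fun h => by
        rw [h] at hl; simp only [i] at hl; omega
      rw [Function.update_of_ne hli]
      by_cases hlj : l = j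
      · rw [hlj, Function.update_self]
      · rw [Function.update_of_ne hlj]
        refine hw0 l (lt_of_le_of_ne hl fun h => hlj (Fin.ext h.symm))
    · intro _
      exact ⟨u, E.refl u, fun l hl => absurd l.2 (by omega)⟩
  obtain ⟨w, hw, hw0⟩ := key
  have hw' : w = Function.update (0 : Fin N → ℤ × ℤ) 0 ((w 0).1, (w 0).2) := by
    funext l
    by_cases hl : l = 0
    · subst hl; simp
    · rw [Function.update_of_ne hl]
      exact hw0 l (Nat.one_le_iff_ne_zero.2 fun h => hl (Fin.ext (by simpa using h)))
  rw [hw'] at hw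
  exact ⟨_, E.trans hw (powerRel_gcd g 0 0 _ _)⟩

/-! ## Invariance of the greatest common divisor -/

theorem dvd_expGcd_iff {g : G} {v : Fin N ⊕ Fin N → ℤ} {d : ℕ} :
    d ∣ expGcd g v ↔ (∀ k, (d : ℤ) ∣ v k) ∧ d ∣ orderOf g := by
  simp [expGcd, Nat.dvd_gcd_iff, Finset.dvd_gcd_iff, Int.natCast_dvd]

/-- A common divisor of the exponents divides their integral combinations, and congruence modulo
`o(g)` is harmless because `expGcd` divides `o(g)`. Any integral matrix will do; equality comes from
applying this to the inverse operation as well. -/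
theorem expGcd_dvd_of_modEq {g : G} {v w : Fin N ⊕ Fin N → ℤ}
    (A : Matrix (Fin N ⊕ Fin N) (Fin N ⊕ Fin N) ℤ)
    (h : ∀ k, A.mulVec v k ≡ w k [ZMOD orderOf g]) : expGcd g v ∣ expGcd g w := by
  obtain ⟨h1, h2⟩ := dvd_expGcd_iff.1 (dvd_refl (expGcd g v))
  refine dvd_expGcd_iff.2 ⟨fun k => ?_, h2⟩
  have h3 : ((expGcd g v : ℕ) : ℤ) ∣ A.mulVec v k := by
    rw [Matrix.mulVec, dotProduct]
    exact Finset.dvd_sum fun l _ => (h1 l).mul_left _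
  exact (dvd_iff_dvd_of_dvd_sub ((Int.natCast_dvd_natCast.2 h2).trans (h k).dvd)).2 h3

theorem expGcd_dvd_of_actTuple {g : G} {v w : Fin N ⊕ Fin N → ℤ} {φ : MapBdry N}
    (h : actTuple φ.1 (powerTuple g v) = powerTuple g w) : expGcd g v ∣ expGcd g w := by
  rw [actTuple_powerTuple] at h
  refine expGcd_dvd_of_modEq (homologyMatrix φ) fun k => ?_
  rw [← zpow_eq_zpow_iff_modEq]
  rcases k with k | k
  · exact congrArg Prod.fst (congrFun h k)
  · exact congrArg Prod.snd (congrFun h k)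

/-- The vector of exponents as a tuple of pairs. -/
def exponentPairs (v : Fin N ⊕ Fin N → ℤ) : Fin N → ℤ × ℤ :=
  fun i => (v (Sum.inl i), v (Sum.inr i))

/-- The tuple of pairs of exponents as a vector. -/
def exponentVector (u : Fin N → ℤ × ℤ) : Fin N ⊕ Fin N → ℤ :=
  Sum.elim (fun i => (u i).1) (fun i => (u i).2)

/-- `PowerRel` compares tuples rather than their conjugacy classes, so the exponents are known
modulo `o(g)` for every `g`. -/
theorem PowerRel.expGcd_eq {g : G} {u w : Fin N → ℤ × ℤ} (h : PowerRel g u w) :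
    expGcd g (exponentVector u) = expGcd g (exponentVector w) := by
  obtain ⟨φ, hφ⟩ := h
  obtain ⟨ψ, hψ⟩ := (powerRel_equivalence g).symm ⟨φ, hφ⟩
  exact Nat.dvd_antisymm (expGcd_dvd_of_actTuple hφ) (expGcd_dvd_of_actTuple hψ)

theorem powerRel_normalForm [NeZero N] (g : G) (v : Fin N ⊕ Fin N → ℤ) :
    PowerRel g (exponentPairs v) (Function.update 0 0 ((expGcd g v : ℤ), 0)) := by
  have E := powerRel_equivalence (N := N) g
  obtain ⟨e, he⟩ := exists_powerRel_update_zero g (exponentPairs v)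
  -- The trivial second entry is rewritten as `g ^ o(g)`, so that the Euclidean algorithm brings the
  -- order into the gcd.
  have h1 : PowerRel g (Function.update (0 : Fin N → ℤ × ℤ) 0 (e, 0))
      (Function.update 0 0 (e, (orderOf g : ℤ))) := by
    refine ⟨1, (actTuple_one _).trans ?_⟩
    rw [pairPower_update, pairPower_update]
    simp [pow_orderOf_eq_one]
  have h2 := E.trans he (E.trans h1 (powerRel_gcd g 0 0 e (orderOf g)))
  have hv : exponentVector (exponentPairs v) = v := by
    funext k; rcases k with k | k <;> rfl
  -- The value of `e` is not tracked through the reduction; invariance of `expGcd` identifies the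
  -- result.
  have h3 : expGcd g v = Int.gcd e (orderOf g) := by
    rw [← hv, h2.expGcd_eq]
    refine Nat.dvd_antisymm ?_ ?_
    · simpa [exponentVector] using
        Int.natCast_dvd_natCast.1 ((dvd_expGcd_iff.1 (dvd_refl _)).1 (Sum.inl 0))
    · refine dvd_expGcd_iff.2 ⟨?_, Int.gcd_dvd_natAbs_right _ _⟩
      rintro (k | k) <;> by_cases hk : k = 0
      · subst hk; simp [exponentVector]
      · simp [exponentVector, hk]
      · subst hk; simp [exponentVector]
      · simp [exponentVector, hk]
  rwa [h3]

theorem powerClass_mem_mapOrbit {g : G} {v w : Fin N ⊕ Fin N → ℤ}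
    (h : expGcd g v = expGcd g w) : powerClass g w ∈ mapOrbit (powerClass g v) := by
  have hrel : PowerRel g (exponentPairs v) (exponentPairs w) := by
    -- In genus zero there is only the empty tuple, and no first handle for the normal form.
    rcases Nat.eq_zero_or_pos N with rfl | hN
    · exact ⟨1, funext fun i => i.elim0⟩
    · have : NeZero N := ⟨hN.ne'⟩
      have hw := powerRel_normalForm g w
      rw [← h] at hw
      exact (powerRel_equivalence g).trans (powerRel_normalForm g v)
        ((powerRel_equivalence g).symm hw)
  obtain ⟨φ, hφ⟩ := hrel
  exact ⟨QuotientGroup.mk φ, Subtype.ext (congrArg classOf hφ)⟩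

/-! ## Cyclic subgroups whose elements are pairwise not conjugate -/

theorem powerClass_eq_of_modEq {g : G} {v w : Fin N ⊕ Fin N → ℤ}
    (h : ∀ k, v k ≡ w k [ZMOD orderOf g]) : powerClass g v = powerClass g w :=
  powerClass_eq_iff.2 ⟨1, fun k => by
    rw [one_mul, inv_one, mul_one, zpow_eq_zpow_iff_modEq]
    exact (h k).symm⟩

/-- The non-conjugacy hypothesis enters here: the conjugator fixes each of these powers of `g`, so
the class determines the exponents modulo `o(g)`. -/
theorem modEq_of_powerClass_eq {g : G}
    (hg : ∀ x ∈ Subgroup.zpowers g, ∀ y ∈ Subgroup.zpowers g, IsConj x y → x = y)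
    {v w : Fin N ⊕ Fin N → ℤ} (h : powerClass g v = powerClass g w) (k : Fin N ⊕ Fin N) :
    v k ≡ w k [ZMOD orderOf g] := by
  obtain ⟨c, hc⟩ := powerClass_eq_iff.1 h
  rw [← zpow_eq_zpow_iff_modEq]
  exact (hg _ ⟨_, rfl⟩ _ ⟨_, rfl⟩ (isConj_iff.2 ⟨c, hc k⟩)).symm

theorem expGcd_dvd_of_mem_mapOrbit {g : G}
    (hg : ∀ x ∈ Subgroup.zpowers g, ∀ y ∈ Subgroup.zpowers g, IsConj x y → x = y)
    {v w : Fin N ⊕ Fin N → ℤ} (h : powerClass g w ∈ mapOrbit (powerClass g v)) :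
    expGcd g v ∣ expGcd g w := by
  obtain ⟨φ, hφ⟩ := h
  obtain ⟨φ, rfl⟩ := QuotientGroup.mk_surjective φ
  rw [sigma_mk_powerClass] at hφ
  exact expGcd_dvd_of_modEq _ (modEq_of_powerClass_eq hg hφ)

theorem mem_mapOrbit_symm {d d' : FlatClass N G} (h : d' ∈ mapOrbit d) : d ∈ mapOrbit d' := by
  obtain ⟨φ, rfl⟩ := h
  exact ⟨φ⁻¹, by rw [map_inv]; exact Equiv.symm_apply_apply _ _⟩

theorem mem_mapOrbit_iff {g : G}
    (hg : ∀ x ∈ Subgroup.zpowers g, ∀ y ∈ Subgroup.zpowers g, IsConj x y → x = y)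
    (v w : Fin N ⊕ Fin N → ℤ) :
    powerClass g w ∈ mapOrbit (powerClass g v) ↔ expGcd g v = expGcd g w :=
  ⟨fun h => Nat.dvd_antisymm (expGcd_dvd_of_mem_mapOrbit hg h)
    (expGcd_dvd_of_mem_mapOrbit hg (mem_mapOrbit_symm h)), powerClass_mem_mapOrbit⟩

/-! ### Exponents modulo the order of `g`. -/

/-- The class of a tuple of powers of `g` with exponents modulo the order of `g`. -/
noncomputable def powerClassMod (g : G) (z : Fin N ⊕ Fin N → ZMod (orderOf g)) : FlatClass N G :=
  powerClass g fun k => (z k).cast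

theorem powerClassMod_intCast (g : G) (v : Fin N ⊕ Fin N → ℤ) :
    powerClassMod g (fun k => (v k : ZMod (orderOf g))) = powerClass g v :=
  powerClass_eq_of_modEq fun k => by
    rw [← ZMod.intCast_eq_intCast_iff, ZMod.intCast_zmod_cast]

theorem exists_intCast_eq (g : G) (z : Fin N ⊕ Fin N → ZMod (orderOf g)) :
    ∃ v : Fin N ⊕ Fin N → ℤ, z = fun k => (v k : ZMod (orderOf g)) :=
  ⟨fun k => (z k).cast, funext fun k => (ZMod.intCast_zmod_cast (z k)).symm⟩

theorem powerClassMod_injective {g : G}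
    (hg : ∀ x ∈ Subgroup.zpowers g, ∀ y ∈ Subgroup.zpowers g, IsConj x y → x = y) :
    Function.Injective (powerClassMod (N := N) g) := by
  intro z z' h
  obtain ⟨v, rfl⟩ := exists_intCast_eq g z
  obtain ⟨w, rfl⟩ := exists_intCast_eq g z'
  rw [powerClassMod_intCast, powerClassMod_intCast] at h
  exact funext fun k => (ZMod.intCast_eq_intCast_iff _ _ _).2 (modEq_of_powerClass_eq hg h k)

theorem expGcd_dvd_of_mem_spOrbit {g : G} {v w : Fin N ⊕ Fin N → ℤ}
    (h : (fun k => (w k : ZMod (orderOf g))) ∈ spOrbit fun k => (v k : ZMod (orderOf g))) :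
    expGcd g v ∣ expGcd g w := by
  obtain ⟨A, hA⟩ := h
  -- The entries are lifted to integers one by one; the lifted matrix need not be symplectic.
  refine expGcd_dvd_of_modEq (Matrix.of fun k l => (A.1 k l).cast) fun k => ?_
  rw [← ZMod.intCast_eq_intCast_iff, ← congrFun hA k]
  simp [Matrix.mulVec, dotProduct]

theorem mem_spOrbit_symm {R : Type*} [CommRing R] {z z' : Fin N ⊕ Fin N → R}
    (h : z' ∈ spOrbit z) : z ∈ spOrbit z' := by
  obtain ⟨A, rfl⟩ := h
  refine ⟨A⁻¹, ?_⟩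
  rw [Matrix.mulVec_mulVec, ← Submonoid.coe_mul, inv_mul_cancel, Submonoid.coe_one,
    Matrix.one_mulVec]

/-- A mapping class acts by its symplectic matrix reduced modulo `o(g)`, which gives one inclusion.
For the other, vectors in one symplectic orbit have equal `expGcd`, and `powerClass_mem_mapOrbit`
supplies a mapping class; the given symplectic matrix itself is not lifted. -/
theorem mapOrbit_powerClassMod (g : G) (z : Fin N ⊕ Fin N → ZMod (orderOf g)) :
    mapOrbit (powerClassMod g z) = powerClassMod g '' spOrbit z := by
  obtain ⟨v, rfl⟩ := exists_intCast_eq g z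
  refine Set.Subset.antisymm ?_ ?_
  · rintro _ ⟨φ, rfl⟩
    obtain ⟨φ, rfl⟩ := QuotientGroup.mk_surjective φ
    rw [powerClassMod_intCast, sigma_mk_powerClass, ← powerClassMod_intCast]
    refine ⟨_, ⟨⟨_, SymplecticGroup.map_mem (homologyMatrix_mem φ)
      (Int.castRingHom (ZMod (orderOf g)))⟩, ?_⟩, rfl⟩
    funext k
    simp [Matrix.mulVec, dotProduct]
  · rintro _ ⟨z', hz', rfl⟩
    obtain ⟨w, rfl⟩ := exists_intCast_eq g z'
    rw [powerClassMod_intCast, powerClassMod_intCast]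
    exact powerClass_mem_mapOrbit (Nat.dvd_antisymm (expGcd_dvd_of_mem_spOrbit hz')
      (expGcd_dvd_of_mem_spOrbit (mem_spOrbit_symm hz')))

end MCG

open MCG in
theorem theorem3p4 {G : Type*} [Group G] [Finite G] (N : ℕ) (g : G) :
    -- (i) tuples with the same gcd lie in one orbit
    (∀ v w : Fin N ⊕ Fin N → ℤ, expGcd g v = expGcd g w →
      powerClass g w ∈ mapOrbit (powerClass g v)) ∧
    -- (i) the action on classes of tuples of powers factors through `Sp(2N, ℤ)`
    (∃ s : MapClosed N →* Matrix.symplecticGroup (Fin N) ℤ,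
      (∀ φ : MapBdry N, (s (QuotientGroup.mk φ)).1 = homologyMatrix φ) ∧
      ∃ a : Matrix.symplecticGroup (Fin N) ℤ →* Equiv.Perm (powerClasses N g),
        (∀ (A : Matrix.symplecticGroup (Fin N) ℤ) (v : Fin N ⊕ Fin N → ℤ),
          a A ⟨powerClass g v, Set.mem_range_self v⟩ =
            ⟨powerClass g (A.1.mulVec v), Set.mem_range_self _⟩) ∧
        ∀ (φ : MapClosed N) (d : powerClasses N g), sigma N G φ d.1 = (a (s φ) d).1) ∧
    -- (ii)
    ((∀ x ∈ Subgroup.zpowers g, ∀ y ∈ Subgroup.zpowers g, IsConj x y → x = y) →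
      (∀ v w : Fin N ⊕ Fin N → ℤ,
        powerClass g w ∈ mapOrbit (powerClass g v) ↔ expGcd g v = expGcd g w) ∧
      ∃ P : (Fin N ⊕ Fin N → ZMod (orderOf g)) → FlatClass N G,
        (∀ v : Fin N ⊕ Fin N → ℤ, P (fun k => (v k : ZMod (orderOf g))) = powerClass g v) ∧
        Function.Injective P ∧
        ∀ z : Fin N ⊕ Fin N → ZMod (orderOf g), mapOrbit (P z) = P '' spOrbit z) :=
  ⟨fun _ _ h => powerClass_mem_mapOrbit h,
    ⟨symplecticRep N, fun _ => rfl, symplecticAct N g, symplecticAct_mk g,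
      sigma_eq_symplecticAct g⟩,
    fun hg => ⟨mem_mapOrbit_iff hg, powerClassMod g, powerClassMod_intCast g,
      powerClassMod_injective hg, mapOrbit_powerClassMod g⟩⟩
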